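/- Let $(X,\rho)$ be a compact metric space and $T\colon X\to X$ a continuous map. For $x,y\in X$ put $$D_B(x,y)=\limsup_{N\to\infty}\frac1N\sum_{n=0}^{N-1}\rho(T^n(x),T^n(y)),$$ the Besicovitch pseudometric on $X$. A point $x\in X$ is called generic for a Borel probability measure $\mu$ on $X$ if the empirical measures $\frac1n\sum_{j=0}^{n-1}\delta_{T^j(x)}$ converge to $\mu$ in the weak$^*$ topology, that is, if $\frac1n\sum_{j=0}^{n-1}f(T^j(x))\to\int_X f\,d\mu$ for every continuous $f\colon X\to\mathbb R$. A measure is called ergodic if it is a $T$-invariant Borel probability measure that gives measure $0$ or $1$ to every Borel set $B$ with $T^{-1}(B)=B$. Let $(\mu_p)_{p\ge1}$ be a sequence of ergodic measures and $(x_p)_{p\ge1}$ a sequence of points of $X$ such that $x_p$ is generic for $\mu_p$ for every $p$. If $x\in X$ satisfies $D_B(x_p,x)\to0$ as $p\to\infty$, then $x$ is generic for some ergodic measure. Consequently, the set of all points of $X$ that are generic for some ergodic measure is closed in the topology induced on $X$ by the pseudometric $D_B$. -/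

import Mathlib

open Filter Topology MeasureTheory

namespace TopDyn

/-- The average `(1/N) ∑_{n<N} ρ(u n, v n)`. -/
noncomputable def avgDist {X : Type*} [MetricSpace X] (u v : ℕ → X) (N : ℕ) : ℝ :=
  (1 / (N : ℝ)) * ∑ n ∈ Finset.range N, dist (u n) (v n)

/-- The Besicovitch pseudodistance on sequences,
`limsup_{N → ∞} (1/N) ∑_{n<N} ρ(u n, v n)`. On a compact space the averages are bounded
(see `avgDist_le_diam`), so this real `limsup` is the usual one. -/
noncomputable def besicovitchSeqDist {X : Type*} [MetricSpace X] (u v : ℕ → X) : ℝ :=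
  limsup (avgDist u v) atTop

/-- The Besicovitch pseudodistance `D_B(x, y)` of `(X, T)`: the distance between orbits. -/
noncomputable def besicovitchDist {X : Type*} [MetricSpace X] (T : X → X) (x y : X) : ℝ :=
  besicovitchSeqDist (fun n => T^[n] x) (fun n => T^[n] y)

/-- The point `x` is generic for `μ`: the empirical measures `(1/n) ∑_{j<n} δ_{T^j x}` converge
weak-* to `μ`, that is, the averages `(1/n) ∑_{j<n} f (T^j x)` converge to `∫ f dμ` for every
continuous `f : X → ℝ`. -/
def IsGenericFor {X : Type*} [MetricSpace X] [MeasurableSpace X] [BorelSpace X]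
    (T : X → X) (x : X) (μ : ProbabilityMeasure X) : Prop :=
  ∀ f : C(X, ℝ), Tendsto (fun n : ℕ => (1 / (n : ℝ)) * ∑ j ∈ Finset.range n, f (T^[j] x)) atTop
    (𝓝 (∫ y, f y ∂(μ : Measure X)))

/-- The set of all points that are generic for some ergodic Borel probability measure. -/
def ergodicGenericPoints {X : Type*} [MetricSpace X] [MeasurableSpace X] [BorelSpace X]
    (T : X → X) : Set X :=
  {x | ∃ μ : ProbabilityMeasure X, Ergodic T (μ : Measure X) ∧ IsGenericFor T x μ}

section Pseudometric

theorem avgDist_nonneg {X : Type*} [MetricSpace X] (u v : ℕ → X) (N : ℕ) : 0 ≤ avgDist u v N := by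
  unfold avgDist
  exact mul_nonneg (by positivity) (Finset.sum_nonneg fun _ _ => dist_nonneg)

theorem avgDist_le_diam {X : Type*} [MetricSpace X] [CompactSpace X] (u v : ℕ → X) (N : ℕ) :
    avgDist u v N ≤ Metric.diam (Set.univ : Set X) := by
  unfold avgDist
  have hb : ∑ n ∈ Finset.range N, dist (u n) (v n) ≤ N * Metric.diam (Set.univ : Set X) := by
    have := Finset.sum_le_card_nsmul (Finset.range N) (fun n => dist (u n) (v n))
      (Metric.diam (Set.univ : Set X)) (fun n _ =>
        Metric.dist_le_diam_of_mem isCompact_univ.isBounded (Set.mem_univ _) (Set.mem_univ _))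
    simpa using this
  rcases Nat.eq_zero_or_pos N with rfl | hN
  · simpa using Metric.diam_nonneg
  · have hN' : (0 : ℝ) < N := by exact_mod_cast hN
    rw [one_div, inv_mul_le_iff₀ hN']
    exact hb

theorem avgDist_triangle {X : Type*} [MetricSpace X] (u v w : ℕ → X) (N : ℕ) :
    avgDist u w N ≤ avgDist u v N + avgDist v w N := by
  unfold avgDist
  rw [← mul_add, ← Finset.sum_add_distrib]
  exact mul_le_mul_of_nonneg_left (Finset.sum_le_sum fun n _ => dist_triangle _ _ _)
    (by positivity)

theorem avgDist_isBoundedUnder {X : Type*} [MetricSpace X] [CompactSpace X] (u v : ℕ → X) :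
    IsBoundedUnder (· ≤ ·) atTop (avgDist u v) :=
  isBoundedUnder_of ⟨_, avgDist_le_diam u v⟩

theorem avgDist_isBoundedUnder_ge {X : Type*} [MetricSpace X] (u v : ℕ → X) :
    IsBoundedUnder (· ≥ ·) atTop (avgDist u v) :=
  isBoundedUnder_of ⟨0, avgDist_nonneg u v⟩

theorem besicovitchSeqDist_self {X : Type*} [MetricSpace X] (u : ℕ → X) :
    besicovitchSeqDist u u = 0 := by
  have : avgDist u u = fun _ => 0 := by
    funext N
    simp [avgDist]
  rw [besicovitchSeqDist, this, limsup_const]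

theorem besicovitchSeqDist_comm {X : Type*} [MetricSpace X] (u v : ℕ → X) :
    besicovitchSeqDist u v = besicovitchSeqDist v u := by
  have : avgDist u v = avgDist v u := by
    funext N
    simp [avgDist, dist_comm]
  rw [besicovitchSeqDist, besicovitchSeqDist, this]

theorem besicovitchSeqDist_triangle {X : Type*} [MetricSpace X] [CompactSpace X]
    (u v w : ℕ → X) :
    besicovitchSeqDist u w ≤ besicovitchSeqDist u v + besicovitchSeqDist v w := by
  have h1 : besicovitchSeqDist u w ≤ limsup (avgDist u v + avgDist v w) atTop := by
    refine limsup_le_limsup (Eventually.of_forall fun N => avgDist_triangle u v w N)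
      (avgDist_isBoundedUnder_ge u w).isCoboundedUnder_le ?_
    exact isBoundedUnder_of ⟨_, fun N => add_le_add (avgDist_le_diam u v N) (avgDist_le_diam v w N)⟩
  exact h1.trans (limsup_add_le (avgDist_isBoundedUnder_ge u v) (avgDist_isBoundedUnder u v)
    (avgDist_isBoundedUnder_ge v w).isCoboundedUnder_le (avgDist_isBoundedUnder v w))

/-- `D_B` as a pseudometric on `X`, used for the topology it induces. It is not an instance, so
it does not interfere with the original metric. -/
@[reducible] noncomputable def besicovitchPseudoMetric {X : Type*} [MetricSpace X] [CompactSpace X]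
    (T : X → X) : PseudoMetricSpace X where
  dist := besicovitchDist T
  dist_self _ := besicovitchSeqDist_self _
  dist_comm _ _ := besicovitchSeqDist_comm _ _
  dist_triangle _ _ _ := besicovitchSeqDist_triangle _ _ _

/-- The topology on `X` induced by the pseudometric `D_B`. -/
@[reducible] noncomputable def besicovitchTopology {X : Type*} [MetricSpace X] [CompactSpace X]
    (T : X → X) : TopologicalSpace X :=
  (besicovitchPseudoMetric T).toUniformSpace.toTopologicalSpace

end Pseudometric

end TopDyn

/-!
A `T`-invariant probability measure `μ` is ergodic if and only if, for every continuous `f`, the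
Cesàro means of the autocorrelations `∫ f · f ∘ T^j dμ` tend to `(∫ f dμ)²`: by the mean ergodic
theorem they always tend to `‖P f‖²`, where `P` is the orthogonal projection of `L²(μ)` onto the
invariant functions. If `x` and `y` are generic for `μ` and `ν` and `D_B(x, y)` is small, then the
autocorrelations of `μ` and `ν` are close uniformly in the lag `j`, since `T^j` does not increase
`D_B`. Thanks to this uniformity the criterion for ergodicity passes from the `μ_p` to any weak-*
cluster point of them, and `x` is generic for that cluster point.
-/

namespace TopDyn

section CesaroMean

/-- The Cesàro mean `(1/N) ∑_{n<N} a n`. It is written so that `avgDist` and the averages in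
`IsGenericFor` are Cesàro means by definition. -/
noncomputable def cesaroMean (a : ℕ → ℝ) (N : ℕ) : ℝ :=
  (1 / (N : ℝ)) * ∑ n ∈ Finset.range N, a n

theorem cesaroMean_add (a b : ℕ → ℝ) (N : ℕ) :
    cesaroMean (fun n => a n + b n) N = cesaroMean a N + cesaroMean b N := by
  simp only [cesaroMean, Finset.sum_add_distrib, mul_add]

theorem cesaroMean_const_mul (c : ℝ) (a : ℕ → ℝ) (N : ℕ) :
    cesaroMean (fun n => c * a n) N = c * cesaroMean a N := by
  simp only [cesaroMean, ← Finset.mul_sum, mul_left_comm]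

theorem cesaroMean_const_le {c : ℝ} (hc : 0 ≤ c) (N : ℕ) : cesaroMean (fun _ => c) N ≤ c := by
  simpa [cesaroMean, ← mul_assoc] using mul_le_of_le_one_left hc (inv_mul_le_one (a := (N : ℝ)))

theorem cesaroMean_mono {a b : ℕ → ℝ} (h : ∀ n, a n ≤ b n) (N : ℕ) :
    cesaroMean a N ≤ cesaroMean b N :=
  mul_le_mul_of_nonneg_left (Finset.sum_le_sum fun n _ => h n) (by positivity)

theorem abs_cesaroMean_sub_le (a b : ℕ → ℝ) (N : ℕ) :
    |cesaroMean a N - cesaroMean b N| ≤ cesaroMean (fun n => |a n - b n|) N := by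
  rw [cesaroMean, cesaroMean, ← mul_sub, ← Finset.sum_sub_distrib, abs_mul,
    abs_of_nonneg (by positivity)]
  exact mul_le_mul_of_nonneg_left (Finset.abs_sum_le_sum_abs _ _) (by positivity)

theorem cesaroMean_succ_le {a : ℕ → ℝ} {M : ℝ} (ha : ∀ n, 0 ≤ a n) (haM : ∀ n, a n ≤ M) (N : ℕ) :
    cesaroMean (fun n => a (n + 1)) N ≤ cesaroMean a N + M / N := by
  have hsum : ∑ n ∈ Finset.range N, a (n + 1) ≤ ∑ n ∈ Finset.range N, a n + M := by
    linarith [Finset.sum_range_succ a N, Finset.sum_range_succ' a N, ha 0, haM N]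
  calc cesaroMean (fun n => a (n + 1)) N
      ≤ (1 / (N : ℝ)) * (∑ n ∈ Finset.range N, a n + M) :=
        mul_le_mul_of_nonneg_left hsum (by positivity)
    _ = cesaroMean a N + M / N := by rw [cesaroMean]; ring

end CesaroMean

section Limits

theorem tendsto_of_mapClusterPt_of_eventually_dist_lt {ι κ E : Type*} [PseudoMetricSpace E]
    {l : Filter ι} {l' : Filter κ} {F : ι → κ → E} {g : κ → E} {L : ι → E} {a : E}
    (hF : ∀ i, Tendsto (F i) l' (𝓝 (L i))) (hL : MapClusterPt a l L)
    (hFg : ∀ ε > 0, ∀ᶠ i in l, ∀ᶠ k in l', dist (F i k) (g k) < ε) : Tendsto g l' (𝓝 a) := by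
  rw [Metric.tendsto_nhds]
  intro ε hε
  obtain ⟨i, hia, hig⟩ := ((hL.frequently (Metric.ball_mem_nhds a (by positivity : 0 < ε / 3)))
    |>.and_eventually (hFg (ε / 3) (by positivity))).exists
  filter_upwards [hig, Metric.tendsto_nhds.1 (hF i) (ε / 3) (by positivity)] with k hgk hLk
  calc dist (g k) a
      ≤ dist (g k) (F i k) + dist (F i k) (L i) + dist (L i) a := dist_triangle4 _ _ _ _
    _ < ε / 3 + ε / 3 + ε / 3 := by rw [dist_comm (g k)]; gcongr
    _ = ε := add_thirds ε

theorem exists_dist_le_add_mul_dist {X Y : Type*} [PseudoMetricSpace X] [PseudoMetricSpace Y]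
    {f : X → Y} (hf : UniformContinuous f) (hb : Bornology.IsBounded (Set.range f)) {ε : ℝ}
    (hε : 0 < ε) : ∃ C > 0, ∀ x y, dist (f x) (f y) ≤ ε + C * dist x y := by
  obtain ⟨δ, hδ, hfδ⟩ := Metric.uniformContinuous_iff.1 hf ε hε
  refine ⟨(Metric.diam (Set.range f) + 1) / δ, by positivity, fun x y => ?_⟩
  rcases lt_or_ge (dist x y) δ with hxy | hxy
  · have : 0 ≤ (Metric.diam (Set.range f) + 1) / δ * dist x y := by positivity
    linarith [hfδ hxy]
  · have hdiam : dist (f x) (f y) ≤ Metric.diam (Set.range f) :=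
      Metric.dist_le_diam_of_mem hb (Set.mem_range_self x) (Set.mem_range_self y)
    have : Metric.diam (Set.range f) + 1 ≤
        (Metric.diam (Set.range f) + 1) / δ * dist x y := by
      rw [div_mul_eq_mul_div, le_div_iff₀ hδ]
      gcongr
    linarith

theorem isClosed_of_forall_tendsto_dist {Y : Type*} [PseudoMetricSpace Y] {s : Set Y}
    (h : ∀ (xs : ℕ → Y) (x : Y), (∀ n, xs n ∈ s) →
      Tendsto (fun n => dist (xs n) x) atTop (𝓝 0) → x ∈ s) : IsClosed s :=
  IsSeqClosed.isClosed fun xs x hxs hx => h xs x hxs (tendsto_iff_dist_tendsto_zero.1 hx)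

end Limits

section BesicovitchDist

variable {X Y : Type*} [MetricSpace X] [CompactSpace X] [MetricSpace Y] [CompactSpace Y]

theorem exists_forall_besicovitchSeqDist_lt_eventually_cesaroMean (f : C(X, ℝ)) {ε : ℝ}
    (hε : 0 < ε) : ∃ δ > 0, ∀ u v : ℕ → X, besicovitchSeqDist u v < δ →
      ∀ᶠ N in atTop, |cesaroMean (fun n => f (u n)) N - cesaroMean (fun n => f (v n)) N| < ε := by
  obtain ⟨C, hC, hf⟩ := exists_dist_le_add_mul_dist
    (CompactSpace.uniformContinuous_of_continuous f.continuous)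
    (isCompact_range f.continuous).isBounded (half_pos hε)
  refine ⟨ε / 2 / C, by positivity, fun u v huv => ?_⟩
  filter_upwards [eventually_lt_of_limsup_lt huv (avgDist_isBoundedUnder u v)] with N hN
  calc |cesaroMean (fun n => f (u n)) N - cesaroMean (fun n => f (v n)) N|
      ≤ cesaroMean (fun n => |f (u n) - f (v n)|) N := abs_cesaroMean_sub_le _ _ N
    _ ≤ cesaroMean (fun n => ε / 2 + C * dist (u n) (v n)) N :=
        cesaroMean_mono (fun n => hf (u n) (v n)) N
    _ = cesaroMean (fun _ => ε / 2) N + C * avgDist u v N := by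
        rw [cesaroMean_add, cesaroMean_const_mul]; rfl
    _ < ε / 2 + C * (ε / 2 / C) :=
        add_lt_add_of_le_of_lt (cesaroMean_const_le (by positivity) N) (by gcongr)
    _ = ε := by rw [mul_div_cancel₀ _ hC.ne', add_halves]

theorem besicovitchSeqDist_prodMk_le (u v : ℕ → X) (u' v' : ℕ → Y) :
    besicovitchSeqDist (fun n => (u n, u' n)) (fun n => (v n, v' n)) ≤
      besicovitchSeqDist u v + besicovitchSeqDist u' v' := by
  have hle : avgDist (fun n => (u n, u' n)) (fun n => (v n, v' n)) ≤
      avgDist u v + avgDist u' v' := fun N =>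
    (cesaroMean_mono (b := fun n => dist (u n) (v n) + dist (u' n) (v' n))
      (fun n => max_le_add_of_nonneg dist_nonneg dist_nonneg) N).trans_eq (cesaroMean_add _ _ N)
  have hbdd : IsBoundedUnder (· ≤ ·) atTop (avgDist u v + avgDist u' v') :=
    isBoundedUnder_of ⟨_, fun N => add_le_add (avgDist_le_diam u v N) (avgDist_le_diam u' v' N)⟩
  exact (limsup_le_limsup (Eventually.of_forall hle)
      (avgDist_isBoundedUnder_ge _ _).isCoboundedUnder_le hbdd).trans
    (limsup_add_le (avgDist_isBoundedUnder_ge u v) (avgDist_isBoundedUnder u v)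
      (avgDist_isBoundedUnder_ge u' v').isCoboundedUnder_le (avgDist_isBoundedUnder u' v'))

theorem besicovitchSeqDist_succ_le (u v : ℕ → X) :
    besicovitchSeqDist (fun n => u (n + 1)) (fun n => v (n + 1)) ≤ besicovitchSeqDist u v := by
  set D := Metric.diam (Set.univ : Set X)
  have hle : avgDist (fun n => u (n + 1)) (fun n => v (n + 1)) ≤
      avgDist u v + fun N : ℕ => D / N :=
    cesaroMean_succ_le (fun n => dist_nonneg) fun n =>
      Metric.dist_le_diam_of_mem isCompact_univ.isBounded (Set.mem_univ (u n)) (Set.mem_univ (v n))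
  have hD : Tendsto (fun N : ℕ => D / N) atTop (𝓝 0) := tendsto_const_div_atTop_nhds_zero_nat D
  calc besicovitchSeqDist (fun n => u (n + 1)) (fun n => v (n + 1))
      ≤ limsup (avgDist u v + fun N : ℕ => D / N) atTop :=
        limsup_le_limsup (Eventually.of_forall hle)
          (avgDist_isBoundedUnder_ge _ _).isCoboundedUnder_le
          (isBoundedUnder_le_add (avgDist_isBoundedUnder u v) hD.isBoundedUnder_le)
    _ ≤ besicovitchSeqDist u v + limsup (fun N : ℕ => D / N) atTop :=
        limsup_add_le (avgDist_isBoundedUnder_ge u v) (avgDist_isBoundedUnder u v)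
          hD.isCoboundedUnder_le hD.isBoundedUnder_le
    _ = besicovitchSeqDist u v := by rw [hD.limsup_eq, add_zero]

theorem besicovitchDist_iterate_le (T : X → X) (x y : X) (j : ℕ) :
    besicovitchDist T (T^[j] x) (T^[j] y) ≤ besicovitchDist T x y := by
  induction j generalizing x y with
  | zero => rfl
  | succ j ih =>
    exact (ih (T x) (T y)).trans
      (besicovitchSeqDist_succ_le (fun n => T^[n] x) (fun n => T^[n] y))

end BesicovitchDist

section Ergodicity

theorem tendsto_cesaroMean_inner_iterate {E : Type*} [NormedAddCommGroup E] [InnerProductSpace ℝ E]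
    [CompleteSpace E] (U : E →L[ℝ] E) (hU : ‖U‖ ≤ 1) (v : E) :
    Tendsto (cesaroMean fun j => inner ℝ v (U^[j] v)) atTop
      (𝓝 (‖(U.eqLocus (1 : E →L[ℝ] E)).starProjection v‖ ^ 2)) := by
  set P := (U.eqLocus (1 : E →L[ℝ] E)).starProjection
  have hmean : Tendsto (birkhoffAverage ℝ U id · v) atTop (𝓝 (P v)) :=
    U.tendsto_birkhoffAverage_orthogonalProjection hU v
  have hinner : inner ℝ v (P v) = ‖P v‖ ^ 2 := by
    rw [← real_inner_self_eq_norm_sq, Submodule.inner_starProjection_left_eq_right,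
      Submodule.starProjection_eq_self_iff.2 (Submodule.starProjection_apply_mem _ v)]
  rw [← hinner]
  refine (tendsto_const_nhds.inner hmean).congr fun N => ?_
  simp only [cesaroMean, birkhoffAverage, birkhoffSum, inner_smul_right, inner_sum, one_div, id]

variable {α : Type*} [MeasurableSpace α] {T : α → α} {μ : Measure α}

/-- The Koopman operator `f ↦ f ∘ T` on real `L²(μ)`. -/
noncomputable def koopman (hT : MeasurePreserving T μ μ) : Lp ℝ 2 μ →L[ℝ] Lp ℝ 2 μ :=
  (Lp.compMeasurePreservingₗᵢ ℝ T hT).toContinuousLinearMap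

/-- The orthogonal projection of `L²(μ)` onto the `T`-invariant functions, as an endomorphism of
`L²(μ)`. -/
noncomputable def invariantProjection (hT : MeasurePreserving T μ μ) :
    Lp ℝ 2 μ →L[ℝ] Lp ℝ 2 μ :=
  ((koopman hT).eqLocus (1 : Lp ℝ 2 μ →L[ℝ] Lp ℝ 2 μ)).starProjection

/-- The autocorrelation of the observable `f` at lag `j`. -/
noncomputable def autocorrelation (T : α → α) (μ : Measure α) (f : α → ℝ) (j : ℕ) : ℝ :=
  ∫ x, f x * f (T^[j] x) ∂μ

theorem koopman_iterate_toLp (hT : MeasurePreserving T μ μ) {f : α → ℝ} (hf : MemLp f 2 μ)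
    (j : ℕ) : (koopman hT)^[j] (hf.toLp f) =
      (hf.comp_measurePreserving (hT.iterate j)).toLp (f ∘ T^[j]) := by
  rw [← Lp.toLp_compMeasurePreserving hf (hT.iterate j), ← Lp.compMeasurePreserving_iterate hT]
  rfl

theorem invariantProjection_eq_self_iff (hT : MeasurePreserving T μ μ) {f : Lp ℝ 2 μ} :
    invariantProjection hT f = f ↔ Lp.compMeasurePreserving T hT f = f :=
  Submodule.starProjection_eq_self_iff

theorem comp_invariantProjection_ae_eq (hT : MeasurePreserving T μ μ) (f : Lp ℝ 2 μ) :
    invariantProjection hT f ∘ T =ᵐ[μ] invariantProjection hT f := by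
  have hinv : Lp.compMeasurePreserving T hT (invariantProjection hT f) = invariantProjection hT f :=
    (invariantProjection_eq_self_iff hT).1
      (Submodule.starProjection_eq_self_iff.2 (Submodule.starProjection_apply_mem _ f))
  have hcoe := Lp.coeFn_compMeasurePreserving (invariantProjection hT f) hT
  rw [hinv] at hcoe
  exact hcoe.symm

theorem tendsto_cesaroMean_autocorrelation (hT : MeasurePreserving T μ μ) {f : α → ℝ}
    (hf : MemLp f 2 μ) : Tendsto (cesaroMean (autocorrelation T μ f)) atTop
      (𝓝 (‖invariantProjection hT (hf.toLp f)‖ ^ 2)) := by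
  have hcorr : autocorrelation T μ f =
      fun j => inner ℝ (hf.toLp f) ((koopman hT)^[j] (hf.toLp f)) := by
    funext j
    rw [koopman_iterate_toLp, L2.inner_def]
    refine integral_congr_ae ?_
    filter_upwards [hf.coeFn_toLp, (hf.comp_measurePreserving (hT.iterate j)).coeFn_toLp]
      with x hx hxj
    rw [hx, hxj, real_inner_comm]
    rfl
  rw [hcorr]
  exact tendsto_cesaroMean_inner_iterate _ (LinearIsometry.norm_toContinuousLinearMap_le _) _

variable [IsProbabilityMeasure μ]

theorem integral_eq_inner_const_one (f : Lp ℝ 2 μ) :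
    ∫ x, f x ∂μ = inner ℝ (Lp.const 2 μ (1 : ℝ)) f := by
  rw [← indicatorConstLp_univ, L2.inner_indicatorConstLp_one, Measure.restrict_univ]

theorem integral_invariantProjection (hT : MeasurePreserving T μ μ) (f : Lp ℝ 2 μ) :
    ∫ x, invariantProjection hT f x ∂μ = ∫ x, f x ∂μ := by
  have hone : invariantProjection hT (Lp.const 2 μ 1) = Lp.const 2 μ 1 :=
    (invariantProjection_eq_self_iff hT).2 (Lp.toLp_compMeasurePreserving (memLp_const 1) hT)
  rw [integral_eq_inner_const_one, integral_eq_inner_const_one, invariantProjection,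
    ← Submodule.inner_starProjection_left_eq_right, ← invariantProjection, hone]

theorem norm_sq_invariantProjection_of_ergodic (hT : Ergodic T μ) (f : Lp ℝ 2 μ) :
    ‖invariantProjection hT.toMeasurePreserving f‖ ^ 2 = (∫ x, f x ∂μ) ^ 2 := by
  set Pf := invariantProjection hT.toMeasurePreserving f with hPf
  obtain ⟨c, hc⟩ := hT.ae_eq_const_of_ae_eq_comp_ae (Lp.aestronglyMeasurable Pf)
    (comp_invariantProjection_ae_eq _ f)
  have hint : ∫ x, f x ∂μ = c := by
    rw [← integral_invariantProjection hT.toMeasurePreserving, ← hPf, integral_congr_ae hc]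
    simp
  have hnorm : ‖Pf‖ ^ 2 = ∫ _, c ^ 2 ∂μ := by
    rw [← real_inner_self_eq_norm_sq, L2.inner_def]
    refine integral_congr_ae ?_
    filter_upwards [hc] with x hx
    rw [hx, real_inner_self_eq_norm_sq, Real.norm_eq_abs, sq_abs, Function.const_apply]
  rw [hnorm, hint, integral_const, probReal_univ, one_smul]

theorem ergodic_of_norm_sq_invariantProjection (hT : MeasurePreserving T μ μ)
    (h : ∀ f : Lp ℝ 2 μ, ‖invariantProjection hT f‖ ^ 2 = (∫ x, f x ∂μ) ^ 2) : Ergodic T μ := by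
  refine ⟨hT, ⟨fun s hs hTs => ?_⟩⟩
  set g : Lp ℝ 2 μ := indicatorConstLp 2 hs (measure_ne_top μ s) 1
  have hPg : invariantProjection hT g = g := by
    rw [invariantProjection_eq_self_iff, Lp.indicatorConstLp_compMeasurePreserving]
    simp only [hTs, g]
  have hnorm : ‖g‖ ^ 2 = μ.real s := by
    rw [← real_inner_self_eq_norm_sq, L2.real_inner_indicatorConstLp_one_indicatorConstLp_one,
      Set.inter_self]
  have hint : ∫ x, g x ∂μ = μ.real s := by
    rw [integral_indicatorConstLp, smul_eq_mul, mul_one]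
  -- Applied to the invariant indicator `g`, the hypothesis says `μ s = (μ s) ^ 2`.
  have hsq : μ.real s = μ.real s ^ 2 := hnorm.symm.trans (hPg ▸ hint ▸ h g)
  rw [eventuallyConst_set']
  rcases eq_zero_or_one_of_sq_eq_self hsq.symm with hs0 | hs1
  · exact .inl (ae_eq_empty.2 ((measureReal_eq_zero_iff).1 hs0))
  · exact .inr (ae_eq_univ.2 ((prob_compl_eq_zero_iff hs).2
      ((ENNReal.toReal_eq_one_iff _).1 hs1)))

end Ergodicity

section WeakLimits

variable {X : Type*} [TopologicalSpace X] [MeasurableSpace X] [BorelSpace X] {T : X → X}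

theorem ergodic_iff_tendsto_cesaroMean_autocorrelation [CompactSpace X] [NormalSpace X]
    {μ : Measure X} [IsProbabilityMeasure μ] [μ.WeaklyRegular] (hT : MeasurePreserving T μ μ) :
    Ergodic T μ ↔ ∀ f : C(X, ℝ),
      Tendsto (cesaroMean (autocorrelation T μ f)) atTop (𝓝 ((∫ x, f x ∂μ) ^ 2)) := by
  have hlim (f : C(X, ℝ)) : Tendsto (cesaroMean (autocorrelation T μ f)) atTop
      (𝓝 (‖invariantProjection hT (f.toLp 2 μ ℝ)‖ ^ 2)) :=
    tendsto_cesaroMean_autocorrelation hT (f.memLp μ ℝ)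
  have hint (f : C(X, ℝ)) : ∫ x, f.toLp 2 μ ℝ x ∂μ = ∫ x, f x ∂μ :=
    integral_congr_ae (f.coeFn_toLp μ)
  refine ⟨fun hErg f => ?_, fun h => ergodic_of_norm_sq_invariantProjection hT ?_⟩
  · rw [← hint, ← norm_sq_invariantProjection_of_ergodic hErg]
    exact hlim f
  · refine congrFun ((ContinuousMap.toLp_denseRange ℝ μ ℝ (by simp)).equalizer (by fun_prop) ?_ ?_)
    · simp only [integral_eq_inner_const_one]
      fun_prop
    · funext f
      simpa only [Function.comp_apply, hint] using tendsto_nhds_unique (hlim f) (h f)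

theorem isClosed_setOf_measurePreserving [HasOuterApproxClosed X] (hT : Continuous T) :
    IsClosed {μ : ProbabilityMeasure X | MeasurePreserving T (μ : Measure X) μ} := by
  have heq : {μ : ProbabilityMeasure X | MeasurePreserving T (μ : Measure X) μ} =
      {μ | μ.map hT.measurable.aemeasurable = μ} := by
    ext μ
    exact ⟨fun h => Subtype.ext h.map_eq, fun h => ⟨hT.measurable, congrArg Subtype.val h⟩⟩
  rw [heq]
  exact isClosed_eq (ProbabilityMeasure.continuous_map hT) continuous_id

theorem continuous_integral_continuousMap [CompactSpace X] (f : C(X, ℝ)) :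
    Continuous fun μ : ProbabilityMeasure X => ∫ x, f x ∂(μ : Measure X) :=
  ProbabilityMeasure.continuous_integral_boundedContinuousFunction
    (BoundedContinuousFunction.mkOfCompact f)

end WeakLimits

section ClusterMeasure

variable {X : Type*} [MetricSpace X] [CompactSpace X] [MeasurableSpace X] [BorelSpace X]
  {T : X → X} {ι : Type*} {l : Filter ι} {μ : ι → ProbabilityMeasure X} {ν : ProbabilityMeasure X}
  {xs : ι → X} {x : X}

theorem isGenericFor_of_mapClusterPt (hν : MapClusterPt ν l μ)
    (hgen : ∀ p, IsGenericFor T (xs p) (μ p))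
    (hx : Tendsto (fun p => besicovitchDist T (xs p) x) l (𝓝 0)) : IsGenericFor T x ν := by
  intro f
  refine tendsto_of_mapClusterPt_of_eventually_dist_lt (fun p => hgen p f)
    (hν.continuousAt_comp (continuous_integral_continuousMap f).continuousAt) fun ε hε => ?_
  obtain ⟨δ, hδ, hclose⟩ := exists_forall_besicovitchSeqDist_lt_eventually_cesaroMean f hε
  filter_upwards [hx.eventually_lt_const hδ] with p hp
  exact hclose _ _ hp

theorem exists_forall_besicovitchDist_lt_abs_integral_sub_le (hT : Continuous T)
    (F : C(X × X, ℝ)) {ε : ℝ} (hε : 0 < ε) :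
    ∃ δ > 0, ∀ (x y : X) (μ ν : ProbabilityMeasure X), IsGenericFor T x μ → IsGenericFor T y ν →
      besicovitchDist T x y < δ → ∀ j,
        |∫ z, F (z, T^[j] z) ∂(μ : Measure X) - ∫ z, F (z, T^[j] z) ∂(ν : Measure X)| ≤ ε := by
  obtain ⟨δ, hδ, hclose⟩ := exists_forall_besicovitchSeqDist_lt_eventually_cesaroMean F hε
  refine ⟨δ / 2, half_pos hδ, fun x y μ ν hx hy hxy j => ?_⟩
  let pair (z : X) (n : ℕ) : X × X := (T^[n] z, T^[j] (T^[n] z))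
  have hpair : besicovitchSeqDist (pair x) (pair y) < δ := by
    have hlag : besicovitchSeqDist (fun n => T^[j] (T^[n] x)) (fun n => T^[j] (T^[n] y)) ≤
        besicovitchDist T x y := by
      simpa only [besicovitchDist, ← Function.iterate_add_apply, add_comm j] using
        besicovitchDist_iterate_le T x y j
    calc besicovitchSeqDist (pair x) (pair y)
        ≤ besicovitchDist T x y + besicovitchDist T x y :=
          (besicovitchSeqDist_prodMk_le _ _ _ _).trans (add_le_add_right hlag _)
      _ < δ := by linarith
  let G : C(X, ℝ) := F.comp ⟨fun z => (z, T^[j] z), continuous_id.prodMk (hT.iterate j)⟩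
  exact le_of_tendsto ((hx G).sub (hy G)).abs ((hclose _ _ hpair).mono fun N hN => hN.le)

theorem ergodic_of_mapClusterPt (hT : Continuous T) (hν : MapClusterPt ν l μ)
    (herg : ∀ p, Ergodic T (μ p : Measure X)) (hgen : ∀ p, IsGenericFor T (xs p) (μ p))
    (hx : Tendsto (fun p => besicovitchDist T (xs p) x) l (𝓝 0)) : Ergodic T (ν : Measure X) := by
  have hpres : MeasurePreserving T (ν : Measure X) ν :=
    (isClosed_setOf_measurePreserving hT).mem_of_mapClusterPt hν
      (Eventually.of_forall fun p => (herg p).toMeasurePreserving)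
  have hxν : IsGenericFor T x ν := isGenericFor_of_mapClusterPt hν hgen hx
  refine (ergodic_iff_tendsto_cesaroMean_autocorrelation hpres).2 fun f => ?_
  refine tendsto_of_mapClusterPt_of_eventually_dist_lt
    (fun p => (ergodic_iff_tendsto_cesaroMean_autocorrelation
      (herg p).toMeasurePreserving).1 (herg p) f)
    (hν.continuousAt_comp ((continuous_integral_continuousMap f).pow 2).continuousAt) fun ε hε => ?_
  let F : C(X × X, ℝ) := ⟨fun z => f z.1 * f z.2, by fun_prop⟩
  obtain ⟨δ, hδ, hclose⟩ :=
    exists_forall_besicovitchDist_lt_abs_integral_sub_le hT F (half_pos hε)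
  filter_upwards [hx.eventually_lt_const hδ] with p hp
  refine Eventually.of_forall fun N => ?_
  calc |cesaroMean (autocorrelation T (μ p) f) N - cesaroMean (autocorrelation T ν f) N|
      ≤ cesaroMean (fun j => |autocorrelation T (μ p) f j - autocorrelation T ν f j|) N :=
        abs_cesaroMean_sub_le _ _ N
    _ ≤ cesaroMean (fun _ => ε / 2) N :=
        cesaroMean_mono (hclose (xs p) x (μ p) ν (hgen p) hxν hp) N
    _ ≤ ε / 2 := cesaroMean_const_le (by positivity) N
    _ < ε := half_lt_self hε

theorem exists_ergodic_isGenericFor_of_tendsto [NeBot l] (hT : Continuous T)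
    (herg : ∀ p, Ergodic T (μ p : Measure X)) (hgen : ∀ p, IsGenericFor T (xs p) (μ p))
    (hx : Tendsto (fun p => besicovitchDist T (xs p) x) l (𝓝 0)) :
    ∃ ν : ProbabilityMeasure X, Ergodic T (ν : Measure X) ∧ IsGenericFor T x ν := by
  obtain ⟨ν, hν⟩ := exists_clusterPt_of_compactSpace (map μ l)
  exact ⟨ν, ergodic_of_mapClusterPt hT hν herg hgen hx, isGenericFor_of_mapClusterPt hν hgen hx⟩

end ClusterMeasure

end TopDyn

theorem mainTheorem2 {X : Type*} [MetricSpace X] [CompactSpace X] [MeasurableSpace X]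
    [BorelSpace X] (T : X → X) (hT : Continuous T) :
    (∀ (μ : ℕ → ProbabilityMeasure X) (xs : ℕ → X) (x : X),
      (∀ p, Ergodic T (μ p : Measure X)) →
      (∀ p, TopDyn.IsGenericFor T (xs p) (μ p)) →
      Tendsto (fun p => TopDyn.besicovitchDist T (xs p) x) atTop (𝓝 0) →
      ∃ ν : ProbabilityMeasure X, Ergodic T (ν : Measure X) ∧ TopDyn.IsGenericFor T x ν) ∧
    IsClosed[TopDyn.besicovitchTopology T] (TopDyn.ergodicGenericPoints T) := by
  refine ⟨fun μ xs x => TopDyn.exists_ergodic_isGenericFor_of_tendsto hT, ?_⟩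
  refine @TopDyn.isClosed_of_forall_tendsto_dist X (TopDyn.besicovitchPseudoMetric T) _
    fun xs x hxs hx => ?_
  choose μ herg hgen using hxs
  exact TopDyn.exists_ergodic_isGenericFor_of_tendsto hT herg hgen hx
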